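/- Let $\mathbb Z_+=\{0,1,2,\dots\}$ and $n\ge 1$. For a net $\{u_\alpha\}_{\alpha\in\mathbb Z_+^n}$ of real numbers let $(\triangle_j u)_\alpha=u_{\alpha+\varepsilon_j}-u_\alpha$, where $\varepsilon_j$ is the $j$-th standard unit vector, and for $\beta\in\mathbb Z_+^n$ let $\triangle^\beta=\triangle_1^{\beta_1}\cdots\triangle_n^{\beta_n}$ and $|\beta|=\beta_1+\dots+\beta_n$. The net is called *joint completely monotone* if $(-1)^{|\beta|}(\triangle^\beta u)_\alpha\ge 0$ for all $\alpha,\beta\in\mathbb Z_+^n$; when $n=1$ it is called a *completely monotone sequence*. A joint completely monotone net is called *minimal* if for every $j=1,\dots,n$ and every $\epsilon>0$ the sequence $\{u_{l\varepsilon_j}-\epsilon\,\mathbf 1_{\{0\}}(l)\}_{l\in\mathbb Z_+}$ is not completely monotone. **Theorem.** Let $k\in\mathbb Z_+$, let $a_j,b_j\in(0,\infty)$ for $j=0,\dots,k$, and set $$a(x)=a_0\prod_{j=1}^k(x+a_j),\qquad b(x)=b_0\prod_{j=1}^k(x+b_j).$$ Let $\{c(m)\}_{m\in\mathbb Z_+}$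 be a sequence of positive real numbers. Assume that (A1) $b_1\le a_1\le b_2\le a_2\le\cdots\le b_k\le a_k$, and (A2) $\left\{\frac{c(m)}{a(m)}\right\}_{m\in\mathbb Z_+}$ is a completely monotone sequence. Then: (a) the net $\left\{\frac{c(m)}{b(m)+a(m)n}\right\}_{m,n\in\mathbb Z_+}$ is joint completely monotone; (b) if, moreover, $\left\{\frac{c(m)}{a(m)}\right\}_{m\in\mathbb Z_+}$ is a minimal completely monotone sequence, then $\left\{\frac{c(m)}{b(m)+a(m)n}\right\}_{m,n\in\mathbb Z_+}$ is a minimal joint completely monotone net. -/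

import Mathlib

/-- The operator `△^β = ∏ⱼ △ⱼ^{βⱼ}` on nets indexed by `ℕⁿ`, where
`(△ⱼ a)(α) = a (α + εⱼ) - a α` is the forward difference in the `j`-th coordinate. It is the
composition of the powers of the (mutually commuting) operators `△₁, …, △ₙ`. -/
def multiDiff {n : ℕ} (β : Fin n → ℕ) : ((Fin n → ℕ) → ℝ) → ((Fin n → ℕ) → ℝ) :=
  (List.ofFn fun j : Fin n => (fwdDiff (G := ℝ) (Pi.single j 1 : Fin n → ℕ))^[β j]).foldr
    (fun f g => f ∘ g) id

/-- Joint complete monotonicity of a net: `(-1)^{|β|} △^β a_α ≥ 0` for all `α`, `β`. -/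
def IsJointCompletelyMonotone {n : ℕ} (a : (Fin n → ℕ) → ℝ) : Prop :=
  ∀ β α : Fin n → ℕ, 0 ≤ (-1 : ℝ) ^ (∑ j, β j) * multiDiff β a α

/-- A sequence, regarded as a net indexed by `ℕ¹`. -/
def seqNet (a : ℕ → ℝ) : (Fin 1 → ℕ) → ℝ := fun α => a (α 0)

/-- A completely monotone sequence: the one-dimensional case of joint complete monotonicity. -/
def IsCompletelyMonotone (a : ℕ → ℝ) : Prop :=
  IsJointCompletelyMonotone (seqNet a)

/-- A joint completely monotone net is minimal if, along every coordinate axis, decreasing the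
value at the origin by any `ε > 0` destroys complete monotonicity of the resulting sequence. -/
def IsMinimalJointCompletelyMonotone {n : ℕ} (a : (Fin n → ℕ) → ℝ) : Prop :=
  IsJointCompletelyMonotone a ∧
    ∀ (j : Fin n) (ε : ℝ), 0 < ε →
      ¬ IsCompletelyMonotone (fun k : ℕ => a (Pi.single j k) - if k = 0 then ε else 0)

/-- A minimal completely monotone sequence: the one-dimensional case of minimality. -/
def IsMinimalCompletelyMonotone (a : ℕ → ℝ) : Prop :=
  IsMinimalJointCompletelyMonotone (seqNet a)

/-- The polynomial function `x ↦ r₀ ∏ⱼ (x + rⱼ)`. -/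
def prodPoly {k : ℕ} (r₀ : ℝ) (r : Fin k → ℝ) (x : ℝ) : ℝ :=
  r₀ * ∏ j, (x + r j)

/-!
Write `r = b / a`, so that the net is `(c(m) / a(m)) · 1 / (r(m) + n)`. Its `q`-th signed difference
in `n` is `(c(m) / a(m)) · q! · ∏_{i ≤ q} 1 / (r(m) + n + i)` (`negDiff_pow_inv`), and joint complete
monotonicity says that this is completely monotone in `m` for all `q` and `n`. As products of
completely monotone sequences are completely monotone (`CMUpTo.mul`, by the Leibniz rule), only the
factors `1 / (r + i)` matter. Interlacing gives `r = (b₀ / a₀) (1 - ∑ A j / (x + a j))` with `A j ≥ 0`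
(`exists_partialFraction`), so `△ r` is completely monotone, and reciprocals of positive sequences
with this property are completely monotone (`CMUpTo.inv`).

A completely monotone sequence `u` is minimal iff `(-1)^p △^p u (0) → 0`, that is, iff its
representing measure on `[0, 1]` has no atom at `0` (`NoAtomZero`). This class is closed under
nonnegative combinations and under division by `m + t` for `t > 0`
(`NoAtomZero.mul_inv_natCast_add`). On the first axis the net is
`c / b = (a₀ / b₀) (c / a) ∏ (1 + (a j - b j) / (m + b j))`, on the second a multiple of
`1 / (n + r(0))`; both lie in the class.
-/

/-! ### Complete monotonicity up to a given order -/

/-- The negated forward difference `-△` on real sequences, as a linear operator. Its powers absorb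
the signs in the definition of complete monotonicity. -/
def negDiff : (ℕ → ℝ) →ₗ[ℝ] (ℕ → ℝ) where
  toFun u m := u m - u (m + 1)
  map_add' u v := by ext m; simp only [Pi.add_apply]; ring
  map_smul' t u := by ext m; simp only [Pi.smul_apply, smul_eq_mul, RingHom.id_apply]; ring

theorem negDiff_apply (u : ℕ → ℝ) (m : ℕ) : negDiff u m = u m - u (m + 1) := rfl

theorem negDiff_pow_succ (p : ℕ) (u : ℕ → ℝ) :
    (negDiff ^ (p + 1)) u = (negDiff ^ p) (negDiff u) := by
  rw [pow_succ, Module.End.mul_apply]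

theorem negDiff_pow_succ_apply (p : ℕ) (u : ℕ → ℝ) (m : ℕ) :
    (negDiff ^ (p + 1)) u m = (negDiff ^ p) u m - (negDiff ^ p) u (m + 1) := by
  rw [pow_succ', Module.End.mul_apply, negDiff_apply]

theorem negDiff_pow_shift (p : ℕ) (u : ℕ → ℝ) (m : ℕ) :
    (negDiff ^ p) (fun l => u (l + 1)) m = (negDiff ^ p) u (m + 1) := by
  induction p generalizing m with
  | zero => rfl
  | succ p ih => simp only [negDiff_pow_succ_apply, ih]

/-- Complete monotonicity tested only on differences of order at most `N`. The truncation makes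
induction on the order possible for reciprocals. -/
def CMUpTo (N : ℕ) (u : ℕ → ℝ) : Prop :=
  ∀ p ≤ N, ∀ m, 0 ≤ (negDiff ^ p) u m

theorem cmUpTo_zero {u : ℕ → ℝ} : CMUpTo 0 u ↔ ∀ m, 0 ≤ u m := by
  simp [CMUpTo]

theorem cmUpTo_succ {N : ℕ} {u : ℕ → ℝ} :
    CMUpTo (N + 1) u ↔ (∀ m, 0 ≤ u m) ∧ CMUpTo N (negDiff u) := by
  refine ⟨fun h => ⟨fun m => h 0 (by omega) m, fun p hp m => ?_⟩, fun h p hp m => ?_⟩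
  · rw [← negDiff_pow_succ]
    exact h (p + 1) (by omega) m
  · cases p with
    | zero => exact h.1 m
    | succ p =>
      rw [negDiff_pow_succ]
      exact h.2 p (by omega) m

namespace CMUpTo

variable {N : ℕ} {u v : ℕ → ℝ}

theorem mono {M : ℕ} (h : CMUpTo N u) (hM : M ≤ N) : CMUpTo M u :=
  fun p hp => h p (hp.trans hM)

theorem nonneg (h : CMUpTo N u) (m : ℕ) : 0 ≤ u m := h 0 (Nat.zero_le _) m

theorem shift (h : CMUpTo N u) : CMUpTo N (fun m => u (m + 1)) := fun p hp m => by
  rw [negDiff_pow_shift]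
  exact h p hp (m + 1)

theorem add (hu : CMUpTo N u) (hv : CMUpTo N v) : CMUpTo N (u + v) := fun p hp m => by
  rw [map_add]
  exact add_nonneg (hu p hp m) (hv p hp m)

theorem smul {t : ℝ} (ht : 0 ≤ t) (hu : CMUpTo N u) : CMUpTo N (t • u) := fun p hp m => by
  rw [map_smul]
  exact mul_nonneg ht (hu p hp m)

theorem mul (hu : CMUpTo N u) (hv : CMUpTo N v) : CMUpTo N (u * v) := by
  induction N generalizing u v with
  | zero =>
    rw [cmUpTo_zero] at *
    exact fun m => mul_nonneg (hu m) (hv m)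
  | succ N ih =>
    have leibniz : negDiff (u * v) = negDiff u * v + (fun m => u (m + 1)) * negDiff v := by
      ext m
      simp only [negDiff_apply, Pi.mul_apply, Pi.add_apply]
      ring
    refine cmUpTo_succ.2 ⟨fun m => mul_nonneg (hu.nonneg m) (hv.nonneg m), ?_⟩
    rw [leibniz]
    exact (ih (cmUpTo_succ.1 hu).2 (hv.mono N.le_succ)).add
      (ih (hu.mono N.le_succ).shift (cmUpTo_succ.1 hv).2)

theorem const {t : ℝ} (ht : 0 ≤ t) : CMUpTo N (fun _ => t) := by
  induction N generalizing t with
  | zero => exact cmUpTo_zero.2 fun _ => ht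
  | succ N ih =>
    refine cmUpTo_succ.2 ⟨fun _ => ht, ?_⟩
    convert ih le_rfl using 1
    ext m
    simp [negDiff_apply]

theorem sum {ι : Type*} {s : Finset ι} {f : ι → ℕ → ℝ} (h : ∀ i ∈ s, CMUpTo N (f i)) :
    CMUpTo N (∑ i ∈ s, f i) :=
  Finset.sum_induction f (CMUpTo N) (fun _ _ => add) (const le_rfl) h

theorem prod {ι : Type*} {s : Finset ι} {f : ι → ℕ → ℝ} (h : ∀ i ∈ s, CMUpTo N (f i)) :
    CMUpTo N (∏ i ∈ s, f i) :=
  Finset.prod_induction f (CMUpTo N) (fun _ _ => mul) (const zero_le_one) h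

/-- The discrete form of "the reciprocal of a Bernstein function is completely monotone". The
identity `-△(1/g) = △g · (1/g) · (1/g)(· + 1)` expresses the differences of `1/g` of order
`N + 1` through those of order at most `N`. -/
theorem inv {g : ℕ → ℝ} (hg : ∀ m, 0 < g m) (hd : ∀ N, CMUpTo N (-negDiff g)) :
    CMUpTo N (fun m => (g m)⁻¹) := by
  induction N with
  | zero => exact cmUpTo_zero.2 fun m => (inv_pos.2 (hg m)).le
  | succ N ih =>
    refine cmUpTo_succ.2 ⟨fun m => (inv_pos.2 (hg m)).le, ?_⟩
    convert (hd N).mul (ih.mul ih.shift) using 1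
    ext m
    have h₀ := (hg m).ne'
    have h₁ := (hg (m + 1)).ne'
    simp only [negDiff_apply, Pi.mul_apply, Pi.neg_apply]
    field_simp
    ring

theorem inv_natCast_add {t : ℝ} (ht : 0 < t) : CMUpTo N (fun m => ((m : ℝ) + t)⁻¹) := by
  refine inv (fun m => by positivity) fun M => ?_
  convert const (N := M) zero_le_one using 1
  ext m
  simp [negDiff_apply]

end CMUpTo

/-! ### Partial fractions of an interlacing quotient -/

/-- Under interlacing the quotient `∏ (x + b j) / (x + a j)` is `1` minus a nonnegative
combination of the functions `1 / (x + a j)`. The poles `a j` may coincide, which is why the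
coefficients are built by induction rather than as residues. -/
theorem exists_partialFraction (k : ℕ) (a b : Fin k → ℝ) (ha : ∀ j, 0 < a j)
    (hba : ∀ j, b j ≤ a j) (hab : ∀ i j, i < j → a i ≤ b j) :
    ∃ A : Fin k → ℝ, (∀ j, 0 ≤ A j) ∧ ∀ x : ℝ, 0 ≤ x →
      ∏ j, (x + b j) / (x + a j) = 1 - ∑ j, A j * (x + a j)⁻¹ := by
  induction k with
  | zero => exact ⟨0, fun _ => le_rfl, fun x _ => by simp⟩
  | succ k ih =>
    obtain ⟨A, hA, hx⟩ := ih (fun j => a j.castSucc) (fun j => b j.castSucc) (fun j => ha _)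
      (fun j => hba _) (fun i j hij => hab _ _ (by simpa using hij))
    rcases (hba (Fin.last k)).eq_or_lt with he | hlt
    · refine ⟨Fin.snoc A 0, fun j => ?_, fun x h0 => ?_⟩
      · cases j using Fin.lastCases with
        | last => simp
        | cast j => simpa using hA j
      · have := (add_pos_of_nonneg_of_pos h0 (ha (Fin.last k))).ne'
        rw [Fin.prod_univ_castSucc, hx x h0, Fin.sum_univ_castSucc, he, div_self this]
        simp
    · set p := a (Fin.last k)
      set q := b (Fin.last k)
      have hq : ∀ j : Fin k, a j.castSucc ≤ q := fun j => hab _ _ (Fin.castSucc_lt_last j)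
      have hp : ∀ j : Fin k, 0 < p - a j.castSucc := fun j => by linarith [hq j]
      refine ⟨Fin.snoc (fun j => A j * (q - a j.castSucc) / (p - a j.castSucc))
        ((p - q) * (1 + ∑ j, A j / (p - a j.castSucc))), fun j => ?_, fun x h0 => ?_⟩
      · cases j using Fin.lastCases with
        | last =>
          simp only [Fin.snoc_last]
          exact mul_nonneg (by linarith) (add_nonneg zero_le_one
            (Finset.sum_nonneg fun j _ => div_nonneg (hA j) (hp j).le))
        | cast j =>
          simp only [Fin.snoc_castSucc]
          exact div_nonneg (mul_nonneg (hA j) (by linarith [hq j])) (hp j).le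
      · have hxp : x + p ≠ 0 := (add_pos_of_nonneg_of_pos h0 (ha _)).ne'
        -- One pole at a time: split `1 / ((x + a j) (x + p))` into its two simple fractions.
        have key : ∀ j : Fin k, A j * (q - a j.castSucc) / (p - a j.castSucc) *
              (x + a j.castSucc)⁻¹ =
            A j * (x + a j.castSucc)⁻¹ * ((x + q) / (x + p)) -
              (p - q) * (A j / (p - a j.castSucc)) * (x + p)⁻¹ := fun j => by
          have h₁ := (hp j).ne'
          have h₂ := (add_pos_of_nonneg_of_pos h0 (ha j.castSucc)).ne'
          field_simp
          ring
        rw [Fin.prod_univ_castSucc, hx x h0, Fin.sum_univ_castSucc]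
        simp only [Fin.snoc_castSucc, Fin.snoc_last]
        rw [Finset.sum_congr rfl fun j _ => key j, Finset.sum_sub_distrib, ← Finset.sum_mul,
          ← Finset.sum_mul, ← Finset.mul_sum]
        change _ * ((x + q) / (x + p)) = 1 - (_ + _ * (x + p)⁻¹)
        field_simp
        ring

theorem prodPoly_pos {k : ℕ} {r₀ : ℝ} {r : Fin k → ℝ} (h₀ : 0 < r₀) (h : ∀ j, 0 < r j) {x : ℝ}
    (hx : 0 ≤ x) : 0 < prodPoly r₀ r x :=
  mul_pos h₀ (Finset.prod_pos fun j _ => add_pos_of_nonneg_of_pos hx (h j))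

/-- The quotient `b / a` of the interlacing polynomials is a discrete Bernstein function: its
forward difference is completely monotone. -/
theorem cmUpTo_neg_negDiff_quotient {k : ℕ} {a₀ b₀ : ℝ} {a b : Fin k → ℝ} (ha₀ : 0 < a₀)
    (hb₀ : 0 < b₀) (ha : ∀ j, 0 < a j) (hba : ∀ j, b j ≤ a j)
    (hab : ∀ i j, i < j → a i ≤ b j) (N : ℕ) :
    CMUpTo N (-negDiff fun m : ℕ => prodPoly b₀ b m / prodPoly a₀ a m) := by
  obtain ⟨A, hA, hx⟩ := exists_partialFraction k a b ha hba hab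
  have h : CMUpTo (N + 1) ((b₀ / a₀) • ∑ j, A j • fun m : ℕ => ((m : ℝ) + a j)⁻¹) :=
    .smul (by positivity) (.sum fun j _ => .smul (hA j) (.inv_natCast_add (ha j)))
  convert (cmUpTo_succ.1 h).2 using 1
  have hr : ∀ m : ℕ, prodPoly b₀ b m / prodPoly a₀ a m =
      b₀ / a₀ * (1 - ∑ j, A j * ((m : ℝ) + a j)⁻¹) := fun m => by
    rw [← hx m m.cast_nonneg, Finset.prod_div_distrib, prodPoly, prodPoly, mul_div_mul_comm]
  ext m
  simp only [Pi.neg_apply, negDiff_apply, hr, Pi.smul_apply, Finset.sum_apply, smul_eq_mul]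
  ring

/-! ### Differences of nets and of sequences -/

/-- An iterated partial difference of a net is, up to sign, an iterated difference along the line
through the point in the given coordinate direction. -/
theorem fwdDiff_iterate_eq {n : ℕ} (j : Fin n) (p : ℕ) (f : (Fin n → ℕ) → ℝ) (α : Fin n → ℕ)
    (l : ℕ) :
    (fwdDiff (Pi.single j 1 : Fin n → ℕ))^[p] f (Function.update α j l) =
      (-1) ^ p * (negDiff ^ p) (fun i => f (Function.update α j i)) l := by
  induction p generalizing l with
  | zero => simp
  | succ p ih =>
    have hs : Function.update α j l + Pi.single j 1 = Function.update α j (l + 1) := by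
      ext i
      by_cases h : i = j
      · subst h; simp
      · simp [h]
    rw [Function.iterate_succ_apply', fwdDiff, hs, ih, ih, negDiff_pow_succ_apply]
    ring

theorem neg_one_pow_mul_self_mul (p : ℕ) (x : ℝ) : (-1) ^ p * ((-1) ^ p * x) = x := by
  rw [← mul_assoc, ← mul_pow]
  simp

theorem isCompletelyMonotone_iff {u : ℕ → ℝ} :
    IsCompletelyMonotone u ↔ ∀ p m, 0 ≤ (negDiff ^ p) u m := by
  have h (p m : ℕ) : (-1 : ℝ) ^ p *
      (fwdDiff (Pi.single 0 1 : Fin 1 → ℕ))^[p] (seqNet u) (fun _ => m) =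
      (negDiff ^ p) u m := by
    have h := fwdDiff_iterate_eq (0 : Fin 1) p (seqNet u) (fun _ => m) m
    rw [Function.update_eq_self] at h
    rw [h, neg_one_pow_mul_self_mul]
    simp [seqNet]
  refine ⟨fun H p m => ?_, fun H β α => ?_⟩
  · have := H (fun _ => p) (fun _ => m)
    simpa [multiDiff, h] using this
  · have hα : α = fun _ => α 0 := by
      ext i
      rw [Subsingleton.elim i 0]
    rw [hα]
    simpa [multiDiff, h] using H (β 0) (α 0)

theorem isCompletelyMonotone_iff_cmUpTo {u : ℕ → ℝ} :
    IsCompletelyMonotone u ↔ ∀ N, CMUpTo N u :=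
  isCompletelyMonotone_iff.trans
    ⟨fun h _ p _ => h p, fun h p => h p p le_rfl⟩

/-- The two partial differences of a net on `ℕ²` may be taken one after the other as differences of
sequences, first in the second variable and then in the first. -/
theorem isJointCompletelyMonotone_two {f : ℕ → ℕ → ℝ}
    (h : ∀ q n p m, 0 ≤ (negDiff ^ p) (fun i => (negDiff ^ q) (f i) n) m) :
    IsJointCompletelyMonotone (fun α : Fin 2 → ℕ => f (α 0) (α 1)) := by
  intro β α
  have h₁ (i : ℕ) : (fwdDiff (Pi.single 1 1 : Fin 2 → ℕ))^[β 1]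
        (fun α : Fin 2 → ℕ => f (α 0) (α 1)) (Function.update α 0 i) =
      (-1) ^ β 1 * (negDiff ^ β 1) (f i) (α 1) := by
    have h := fwdDiff_iterate_eq (1 : Fin 2) (β 1) (fun α : Fin 2 → ℕ => f (α 0) (α 1))
      (Function.update α 0 i) (α 1)
    rw [Function.update_eq_self_iff.2 (by simp)] at h
    rw [h]
    simp
  have h₀ := fwdDiff_iterate_eq (0 : Fin 2) (β 0) ((fwdDiff (Pi.single 1 1 : Fin 2 → ℕ))^[β 1]
    (fun α : Fin 2 → ℕ => f (α 0) (α 1))) α (α 0)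
  simp only [h₁, Function.update_eq_self] at h₀
  have hs : (fun i => (-1 : ℝ) ^ β 1 * (negDiff ^ β 1) (f i) (α 1)) =
      (-1 : ℝ) ^ β 1 • fun i => (negDiff ^ β 1) (f i) (α 1) := rfl
  rw [hs, map_smul, Pi.smul_apply, smul_eq_mul] at h₀
  have hm : multiDiff β (fun α : Fin 2 → ℕ => f (α 0) (α 1)) α =
      (fwdDiff (Pi.single 0 1 : Fin 2 → ℕ))^[β 0] ((fwdDiff (Pi.single 1 1 : Fin 2 → ℕ))^[β 1]
        (fun α : Fin 2 → ℕ => f (α 0) (α 1))) α := by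
    simp [multiDiff]
  rw [hm, h₀, Fin.sum_univ_two, pow_add, mul_comm ((-1 : ℝ) ^ β 0), mul_assoc,
    neg_one_pow_mul_self_mul, neg_one_pow_mul_self_mul]
  exact h _ _ _ _

/-- Closed form of the iterated differences of `n ↦ 1 / (x + n)`; the integer shift is kept inside
the product so that every factor is again of the form `1 / (x + i)`. -/
theorem negDiff_pow_inv {x : ℝ} (hx : 0 < x) (q n : ℕ) :
    (negDiff ^ q) (fun n => (x + n)⁻¹) n =
      q.factorial * ∏ i ∈ Finset.range (q + 1), (x + (n + i : ℕ))⁻¹ := by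
  induction q generalizing n with
  | zero => simp
  | succ q ih =>
    have h₁ : ∏ i ∈ Finset.range (q + 1), (x + (n + 1 + i : ℕ))⁻¹ =
        (∏ i ∈ Finset.range q, (x + (n + (i + 1) : ℕ))⁻¹) * (x + (n + (q + 1) : ℕ))⁻¹ := by
      rw [Finset.prod_range_succ]
      simp only [add_assoc, add_comm 1]
    rw [negDiff_pow_succ_apply, ih, ih, h₁, Finset.prod_range_succ _ (q + 1),
      Finset.prod_range_succ', Nat.factorial_succ]
    have h₂ : x + (n + 0 : ℕ) ≠ 0 := by positivity
    have h₃ : x + (n + (q + 1) : ℕ) ≠ 0 := by positivity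
    push_cast at h₂ h₃ ⊢
    field_simp
    ring

/-! ### Minimality -/

/-- The completely monotone sequences whose iterated differences at `0` tend to `0`; equivalently,
those whose representing Hausdorff measure on `[0, 1]` has no atom at `0`. -/
def NoAtomZero (u : ℕ → ℝ) : Prop :=
  (∀ N, CMUpTo N u) ∧ Filter.Tendsto (fun p => (negDiff ^ p) u 0) Filter.atTop (nhds 0)

theorem antitone_negDiff_pow {u : ℕ → ℝ} (hu : ∀ N, CMUpTo N u) :
    Antitone fun p => (negDiff ^ p) u 0 :=
  antitone_nat_of_succ_le fun p => by
    rw [negDiff_pow_succ_apply]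
    linarith [hu p p le_rfl 1]

/-- Complete monotonicity makes the differences at `0` converge to a nonnegative limit. -/
theorem exists_tendsto_negDiff_pow {u : ℕ → ℝ} (hu : ∀ N, CMUpTo N u) :
    ∃ L, 0 ≤ L ∧ (∀ p, L ≤ (negDiff ^ p) u 0) ∧
      Filter.Tendsto (fun p => (negDiff ^ p) u 0) Filter.atTop (nhds L) := by
  have hb : BddBelow (Set.range fun p => (negDiff ^ p) u 0) :=
    ⟨0, by rintro _ ⟨p, rfl⟩; exact hu p p le_rfl 0⟩
  exact ⟨_, le_ciInf fun p => hu p p le_rfl 0, fun p => ciInf_le hb p,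
    tendsto_atTop_ciInf (antitone_negDiff_pow hu) hb⟩

theorem negDiff_pow_single_zero (ε : ℝ) (p m : ℕ) :
    (negDiff ^ p) (fun k => if k = 0 then ε else 0) m = if m = 0 then ε else 0 := by
  induction p generalizing m with
  | zero => rfl
  | succ p ih => simp [negDiff_pow_succ_apply, ih]

theorem negDiff_pow_sub_single (u : ℕ → ℝ) (ε : ℝ) (p m : ℕ) :
    (negDiff ^ p) (fun k => u k - if k = 0 then ε else 0) m =
      (negDiff ^ p) u m - if m = 0 then ε else 0 := by
  have h : (fun k => u k - if k = 0 then ε else 0) =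
      u - fun k => if k = 0 then ε else 0 := rfl
  rw [h, map_sub, Pi.sub_apply, negDiff_pow_single_zero]

namespace NoAtomZero

variable {u v : ℕ → ℝ}

theorem not_isCompletelyMonotone (hu : NoAtomZero u) {ε : ℝ} (hε : 0 < ε) :
    ¬ IsCompletelyMonotone (fun k => u k - if k = 0 then ε else 0) := by
  rw [isCompletelyMonotone_iff]
  intro h
  obtain ⟨p, hp⟩ := (hu.2.eventually (gt_mem_nhds hε)).exists
  have := h p 0
  rw [negDiff_pow_sub_single, if_pos rfl] at this
  linarith

theorem of_isMinimal (hu : IsMinimalCompletelyMonotone u) : NoAtomZero u := by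
  have hcm := isCompletelyMonotone_iff_cmUpTo.1 hu.1
  obtain ⟨L, hL, hle, ht⟩ := exists_tendsto_negDiff_pow hcm
  obtain rfl | hpos := hL.eq_or_lt
  · exact ⟨hcm, ht⟩
  · refine absurd (isCompletelyMonotone_iff.2 fun p m => ?_) (hu.2 0 L hpos)
    have hs : ∀ k, seqNet u (Pi.single 0 k) = u k := fun k => by simp [seqNet]
    simp only [hs, negDiff_pow_sub_single]
    split_ifs with h
    · subst h
      linarith [hle p]
    · simpa using hcm p p le_rfl m

theorem add (hu : NoAtomZero u) (hv : NoAtomZero v) : NoAtomZero (u + v) :=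
  ⟨fun N => (hu.1 N).add (hv.1 N), by simpa [map_add] using hu.2.add hv.2⟩

theorem smul {t : ℝ} (ht : 0 ≤ t) (hu : NoAtomZero u) : NoAtomZero (t • u) :=
  ⟨fun N => (hu.1 N).smul ht, by simpa [map_smul] using hu.2.const_mul t⟩

theorem one : NoAtomZero 1 := by
  refine ⟨fun N => .const zero_le_one, tendsto_const_nhds.congr' ?_⟩
  filter_upwards [Filter.eventually_gt_atTop 0] with p hp
  obtain ⟨p, rfl⟩ := Nat.exists_eq_succ_of_ne_zero hp.ne'
  have : negDiff 1 = 0 := by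
    ext m
    simp [negDiff_apply]
  rw [Nat.succ_eq_add_one, negDiff_pow_succ, this, map_zero, Pi.zero_apply]

end NoAtomZero

/-- Leibniz rule for multiplication by the affine sequence `m ↦ m + t`. -/
theorem negDiff_pow_affine_mul (t : ℝ) (v : ℕ → ℝ) (p m : ℕ) :
    (negDiff ^ (p + 1)) (fun l => (l + t) * v l) m =
      (m + t) * (negDiff ^ (p + 1)) v m - (p + 1) * (negDiff ^ p) v (m + 1) := by
  induction p generalizing m with
  | zero =>
    simp only [zero_add, pow_one, pow_zero, negDiff_apply, Module.End.one_apply]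
    push_cast
    ring
  | succ p ih =>
    rw [negDiff_pow_succ_apply, ih, ih, negDiff_pow_succ_apply (p + 1) v,
      negDiff_pow_succ_apply p v (m + 1)]
    push_cast
    ring

/-- Division by `m + t` creates no atom at `0`. With `d p` and `e p` the `p`-th differences at `0`
of `u / (m + t)` and of `u`, one has `e (p + 1) = t * d (p + 1) - (p + 1) * (d p - d (p + 1))`. If
`d` had a limit `L > 0`, then `d p - d (p + 1)` would eventually exceed `t * L / (2 * (p + 1))`,
against the divergence of the harmonic series. -/
theorem NoAtomZero.mul_inv_natCast_add {u : ℕ → ℝ} (hu : NoAtomZero u) {t : ℝ} (ht : 0 < t) :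
    NoAtomZero (u * fun m : ℕ => ((m : ℝ) + t)⁻¹) := by
  set v : ℕ → ℝ := u * fun m : ℕ => ((m : ℝ) + t)⁻¹ with hv
  have hcm : ∀ N, CMUpTo N v := fun N => (hu.1 N).mul (.inv_natCast_add ht)
  obtain ⟨L, hL, hle, hlim⟩ := exists_tendsto_negDiff_pow hcm
  obtain rfl | hpos := hL.eq_or_lt
  · exact ⟨hcm, hlim⟩
  exfalso
  set d : ℕ → ℝ := fun p => (negDiff ^ p) v 0 with hd
  have huv : u = fun m : ℕ => ((m : ℝ) + t) * v m := by
    ext m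
    have : (m : ℝ) + t ≠ 0 := by positivity
    rw [hv, Pi.mul_apply]
    field_simp
  have hrec (p : ℕ) : (negDiff ^ (p + 1)) u 0 = t * d (p + 1) - (p + 1) * (d p - d (p + 1)) := by
    rw [huv, negDiff_pow_affine_mul]
    simp only [hd, negDiff_pow_succ_apply]
    push_cast
    ring
  have hδ : 0 < t * L / 2 := by positivity
  obtain ⟨P, hP⟩ := Filter.eventually_atTop.1 (hu.2.eventually (gt_mem_nhds hδ))
  have hstep (p : ℕ) (hp : P ≤ p) : t * L / 2 * (1 / ((p : ℝ) + 1)) ≤ d p - d (p + 1) := by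
    have h₁ := hP (p + 1) (by omega)
    have h₂ := mul_le_mul_of_nonneg_left (hle (p + 1)) ht.le
    have h₃ := hrec p
    rw [mul_one_div, div_le_iff₀ (by positivity)]
    linarith
  let H : ℕ → ℝ := fun n => ∑ i ∈ Finset.range n, 1 / ((i : ℝ) + 1)
  have hH : Filter.Tendsto H Filter.atTop Filter.atTop :=
    Real.tendsto_sum_range_one_div_nat_succ_atTop
  have hbound (n : ℕ) (hn : P ≤ n) : t * L / 2 * H n + d n ≤ t * L / 2 * H P + d P := by
    induction n, hn using Nat.le_induction with
    | base => rfl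
    | succ n hn ih =>
      have h₁ : H (n + 1) = H n + 1 / ((n : ℝ) + 1) := Finset.sum_range_succ _ _
      rw [h₁, mul_add]
      linarith [hstep n hn]
  obtain ⟨n, hn, hgt⟩ := ((Filter.eventually_ge_atTop P).and
    ((hH.const_mul_atTop hδ).eventually_gt_atTop (t * L / 2 * H P + d P))).exists
  linarith [hbound n hn, hle n]

/-- Each factor `(m + a j) / (m + b j)` is `1 + (a j - b j) / (m + b j)`. -/
theorem NoAtomZero.mul_prod {u : ℕ → ℝ} (hu : NoAtomZero u) {k : ℕ} {a b : Fin k → ℝ}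
    (hb : ∀ j, 0 < b j) (hba : ∀ j, b j ≤ a j) (s : Finset (Fin k)) :
    NoAtomZero (u * fun m : ℕ => ∏ j ∈ s, ((m : ℝ) + a j) / (m + b j)) := by
  classical
  induction s using Finset.induction_on with
  | empty =>
    convert hu using 1
    ext m
    simp
  | insert j s hj ih =>
    convert ih.add ((ih.mul_inv_natCast_add (hb j)).smul (sub_nonneg.2 (hba j))) using 1
    ext m
    have : (m : ℝ) + b j ≠ 0 := (add_pos_of_nonneg_of_pos m.cast_nonneg (hb j)).ne'
    simp only [Pi.mul_apply, Pi.add_apply, Pi.smul_apply, smul_eq_mul, Finset.prod_insert hj]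
    field_simp
    ring

/-! ### The two-parameter net -/

theorem theorem2p1 (k : ℕ) (a₀ b₀ : ℝ) (a b : Fin k → ℝ) (c : ℕ → ℝ)
    (ha₀ : 0 < a₀) (hb₀ : 0 < b₀) (ha : ∀ j, 0 < a j) (hb : ∀ j, 0 < b j)
    (hc : ∀ m, 0 < c m)
    (hba : ∀ j : Fin k, b j ≤ a j)
    (hab : ∀ i j : Fin k, (i : ℕ) + 1 = (j : ℕ) → a i ≤ b j)
    (hcm : IsCompletelyMonotone (fun m : ℕ => c m / prodPoly a₀ a m)) :
    IsJointCompletelyMonotone (fun α : Fin 2 → ℕ =>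
        c (α 0) / (prodPoly b₀ b (α 0) + prodPoly a₀ a (α 0) * (α 1 : ℝ))) ∧
      (IsMinimalCompletelyMonotone (fun m : ℕ => c m / prodPoly a₀ a m) →
        IsMinimalJointCompletelyMonotone (fun α : Fin 2 → ℕ =>
          c (α 0) / (prodPoly b₀ b (α 0) + prodPoly a₀ a (α 0) * (α 1 : ℝ)))) := by
  have hlt : ∀ i j : Fin k, i < j → a i ≤ b j := by
    rintro ⟨i, hi⟩ ⟨j, hj⟩ hij
    replace hij : i + 1 ≤ j := hij
    induction j, hij using Nat.le_induction with
    | base => exact hab _ _ rfl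
    | succ j hij ih =>
      exact (ih (by omega)).trans ((hba _).trans (hab ⟨j, by omega⟩ ⟨j + 1, hj⟩ rfl))
  have hA (m : ℕ) : 0 < prodPoly a₀ a m := prodPoly_pos ha₀ ha m.cast_nonneg
  have hB (m : ℕ) : 0 < prodPoly b₀ b m := prodPoly_pos hb₀ hb m.cast_nonneg
  set r : ℕ → ℝ := fun m => prodPoly b₀ b m / prodPoly a₀ a m with hr
  have hr_pos (m : ℕ) : 0 < r m := div_pos (hB m) (hA m)
  have hnet (m n : ℕ) : c m / (prodPoly b₀ b m + prodPoly a₀ a m * (n : ℝ)) =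
      c m / prodPoly a₀ a m * (r m + n)⁻¹ := by
    have h₁ := (hA m).ne'
    rw [hr, ← div_eq_mul_inv, div_div]
    congr 1
    field_simp
  have hinv (i N : ℕ) : CMUpTo N (fun m => (r m + i)⁻¹) := by
    refine .inv (fun m => add_pos_of_pos_of_nonneg (hr_pos m) i.cast_nonneg) fun M => ?_
    convert cmUpTo_neg_negDiff_quotient ha₀ hb₀ ha hba hlt M using 1
    ext m
    simp [negDiff_apply, hr]
  have hjoint : IsJointCompletelyMonotone (fun α : Fin 2 → ℕ =>
      c (α 0) / (prodPoly b₀ b (α 0) + prodPoly a₀ a (α 0) * (α 1 : ℝ))) := by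
    refine isJointCompletelyMonotone_two
      (f := fun m n => c m / (prodPoly b₀ b m + prodPoly a₀ a m * (n : ℝ))) fun q n p m => ?_
    have h : CMUpTo p ((fun m => c m / prodPoly a₀ a m) * ((q.factorial : ℝ) •
        ∏ i ∈ Finset.range (q + 1), fun m => (r m + (n + i : ℕ))⁻¹)) :=
      (isCompletelyMonotone_iff_cmUpTo.1 hcm p).mul
        (.smul (by positivity) (.prod fun i _ => hinv _ p))
    convert h p le_rfl m using 2
    ext i
    have hs : (fun n : ℕ => c i / (prodPoly b₀ b i + prodPoly a₀ a i * (n : ℝ))) =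
        (c i / prodPoly a₀ a i) • fun n : ℕ => (r i + n)⁻¹ := by
      ext n
      exact hnet i n
    rw [hs, map_smul, Pi.smul_apply, negDiff_pow_inv (hr_pos i)]
    simp [Finset.prod_apply]
  refine ⟨hjoint, fun hmin => ⟨hjoint, fun j ε hε => ?_⟩⟩
  refine NoAtomZero.not_isCompletelyMonotone ?_ hε
  fin_cases j
  -- The axis `n = 0`: the sequence `c / b`.
  · convert ((NoAtomZero.of_isMinimal hmin).mul_prod hb hba Finset.univ).smul
      (t := a₀ / b₀) (by positivity) using 1
    ext m
    have h₁ : ∏ j, ((m : ℝ) + a j) ≠ 0 :=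
      (Finset.prod_pos fun j _ => add_pos_of_nonneg_of_pos m.cast_nonneg (ha j)).ne'
    have h₂ : ∏ j, ((m : ℝ) + b j) ≠ 0 :=
      (Finset.prod_pos fun j _ => add_pos_of_nonneg_of_pos m.cast_nonneg (hb j)).ne'
    simp [prodPoly, Finset.prod_div_distrib]
    field_simp
  -- The axis `m = 0`: a multiple of `n ↦ 1 / (n + r 0)`.
  · convert (NoAtomZero.one.mul_inv_natCast_add (hr_pos 0)).smul
      (t := c 0 / prodPoly a₀ a (0 : ℕ)) (div_pos (hc 0) (hA 0)).le using 1
    ext n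
    have h := hnet 0 n
    simpa [add_comm] using h
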